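/- **Automata.** A *nondeterministic double input-driven double-head pushdown automaton* over a finite alphabet $\Sigma$ has a finite state set $Q$ with an initial state $q_0$ and a set $F\subseteq Q$ of accepting states, a finite set $\Gamma$ of pushdown symbols with an empty-pushdown symbol $\bot\notin\Gamma$, and for each of its two heads, left and right, a *signature*, that is, a partition $\Sigma=\Sigma_D\cup\Sigma_R\cup\Sigma_N$. A configuration is a triple $(q,w,s)$ of a state, the unread input $w\in\Sigma^*$ and the pushdown content $s\in\Gamma^*$ (top first). In each step either the left head reads and removes the first symbol of $w$, or the right head reads and removes the last symbol of $w$. The symbol $x$ that is read determines the pushdown action through the signature of the moving head: push one symbol if $x\in\Sigma_D$, pop one symbol if $x\in\Sigma_R$ (an empty pushdown store stays empty), leave the store unchanged if $x\in\Sigma_N$. The new state, and the symbol pushed if any, are chosen from a finite (possibly empty) set depending on the state, the moving head, $x$ and the top of the pushdown store ($\bot$ if it is empty). A word $w$ is accepted if some computation leads from $(q_0,w,\lambda)$ to $(q,\lambda,s)$ with $q\in F$ and $s\in\Gamma^*$. The automaton is *input-driven (with a single signature)* if both heads have the same signature, and *deterministic* if there is at most one choice of action in every configuration. The families of accepted languages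 are denoted by $\mathcal L(\mathrm{NIDDHPDA})$ and $\mathcal L(\mathrm{DIDDHPDA})$ (single signature, nondeterministic and deterministic) and $\mathcal L(\mathrm{NDoIDDHPDA})$ and $\mathcal L(\mathrm{DDoIDDHPDA})$ (two signatures). A *double-head pushdown automaton* (without the input-driven restriction) is defined in the same way, except that it has no signatures: in a step each head may read one symbol or stay where it is (so that one head, both heads, or no head moves), and the top of the pushdown store is replaced by a word over $\Gamma$, as permitted by a transition function that assigns finitely many choices to the state, the symbols read (or $\lambda$) and the top of the pushdown store. It is deterministic if there is at most one choice of action in every configuration. **Theorem.** Nondeterminism is strictly stronger than determinism for input-driven double-head pushdown automata: $$\mathcal L(\mathrm{DIDDHPDA})\subsetneq\mathcal L(\mathrm{NIDDHPDA})\qquad\text{and}\qquad \mathcal L(\mathrm{DDoIDDHPDA})\subsetneq\mathcal L(\mathrm{NDoIDDHPDA}).$$ Over the alphabet $\{a,b,c,\$_l,\$_r\}$, the language $$L_{dta}=\{\,a^nb^nc^n\,\$_l\,c^ib^ja^k\mid i,j,k,n\ge 0\,\}\cup\{\,a^ib^jc^k\,\$_r\,c^nb^na^n\mid i,j,k,n\ge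 0\,\}$$ witnesses both strict inclusions: it belongs to $\mathcal L(\mathrm{NIDDHPDA})$ and to $\mathcal L(\mathrm{NDoIDDHPDA})$, but neither to $\mathcal L(\mathrm{DIDDHPDA})$ nor to $\mathcal L(\mathrm{DDoIDDHPDA})$. Moreover, $L_{dta}$ is not accepted by any deterministic double-head pushdown automaton, even without the input-driven restriction. -/

import Mathlib

namespace DoubleHead

/-- The two input heads: `left` moves from left to right, `right` moves from right to left. -/
inductive Head
  | left
  | right

/-- The three classes of input symbols: push, pop and state change only. -/
inductive StackOp
  | push
  | pop
  | skip

/-- `h.attach a w` is the unread input from which the head `h` reads `a`, leaving `w` unread: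
`aw` for the left head and `wa` for the right head. -/
def Head.attach {α : Type} : Head → α → List α → List α
  | .left, a, w => a :: w
  | .right, a, w => w ++ [a]

/-- Configurations `(q, w, s)`: state, unread part of the input, pushdown content (top first). -/
abbrev Config (α Q Γ : Type) : Type := Q × List α × List Γ

/-! ### Input-driven double-head pushdown automata -/

/-- A nondeterministic input-driven double-head pushdown automaton, where each head `h` has its own
signature `sig h`. The third argument of the transition functions is the symbol on top of
the pushdown store, and `none` stands for the empty pushdown symbol `⊥`. A transition function is
undefined where its value is `∅`; `pushδ q h a z` is only used if `sig h a = push`, and likewise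
for `popδ` and `skipδ`. Exactly one head is moved in each step. -/
structure IDPDA (α Q Γ : Type) where
  sig : Head → α → StackOp
  start : Q
  accept : Set Q
  pushδ : Q → Head → α → Option Γ → Set (Q × Γ)
  popδ : Q → Head → α → Option Γ → Set Q
  skipδ : Q → Head → α → Option Γ → Set Q

namespace IDPDA

variable {α Q Γ : Type}

/-- `M.StepBy h c c'`: the automaton `M` moves from `c` to `c'` in one step, with the head `h`.
Popping from the empty pushdown store leaves it empty. -/
inductive StepBy (M : IDPDA α Q Γ) : Head → Config α Q Γ → Config α Q Γ → Prop
  | push {h : Head} {q q' : Q} {a : α} {w : List α} {s : List Γ} {z' : Γ} :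
      M.sig h a = .push → (q', z') ∈ M.pushδ q h a s.head? →
      StepBy M h (q, h.attach a w, s) (q', w, z' :: s)
  | pop {h : Head} {q q' : Q} {a : α} {w : List α} {s : List Γ} :
      M.sig h a = .pop → q' ∈ M.popδ q h a s.head? →
      StepBy M h (q, h.attach a w, s) (q', w, s.tail)
  | skip {h : Head} {q q' : Q} {a : α} {w : List α} {s : List Γ} :
      M.sig h a = .skip → q' ∈ M.skipδ q h a s.head? →
      StepBy M h (q, h.attach a w, s) (q', w, s)

/-- One step of the automaton. -/
def Step (M : IDPDA α Q Γ) (c c' : Config α Q Γ) : Prop := ∃ h, M.StepBy h c c'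

/-- The accepted language: the whole input can be read such that an accepting state is entered. -/
def language (M : IDPDA α Q Γ) : Language α :=
  {w | ∃ q ∈ M.accept, ∃ s : List Γ, Relation.ReflTransGen M.Step (M.start, w, []) (q, [], s)}

/-- Both heads respect the same signature. -/
def SingleSignature (M : IDPDA α Q Γ) : Prop := M.sig .left = M.sig .right

/-- There is at most one choice of action in every configuration. -/
def Deterministic (M : IDPDA α Q Γ) : Prop :=
  ∀ (c : Config α Q Γ) (h₁ h₂ : Head) (c₁ c₂ : Config α Q Γ),
    M.StepBy h₁ c c₁ → M.StepBy h₂ c c₂ → h₁ = h₂ ∧ c₁ = c₂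

end IDPDA

/-! ### General double-head pushdown automata -/

/-- A nondeterministic double-head pushdown automaton without the input-driven restriction.
In `δ q x y z`, the left head reads `x` and the right head reads `y`, where `none` means that
the head is not moved, and `z` is the top of the pushdown store (`none` if it is empty). The top is
replaced by a word of pushdown symbols. Steps that move one head, both heads or no head (empty-word
transitions) are all allowed. -/
structure PDA (α Q Γ : Type) where
  start : Q
  accept : Set Q
  δ : Q → Option α → Option α → Option Γ → Finset (Q × List Γ)

namespace PDA

variable {α Q Γ : Type}

/-- `M.StepBy x y c c'`: the automaton `M` moves from `c` to `c'` in one step, while the left head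
reads `x` and the right head reads `y`. -/
inductive StepBy (M : PDA α Q Γ) : Option α → Option α → Config α Q Γ → Config α Q Γ → Prop
  | mk {x y : Option α} {q q' : Q} {w : List α} {s γ : List Γ} :
      (q', γ) ∈ M.δ q x y s.head? →
      StepBy M x y (q, x.toList ++ w ++ y.toList, s) (q', w, γ ++ s.tail)

/-- One step of the automaton. -/
def Step (M : PDA α Q Γ) (c c' : Config α Q Γ) : Prop := ∃ x y, M.StepBy x y c c'

/-- The accepted language: the whole input can be read such that an accepting state is entered. -/
def language (M : PDA α Q Γ) : Language α :=
  {w | ∃ q ∈ M.accept, ∃ s : List Γ, Relation.ReflTransGen M.Step (M.start, w, []) (q, [], s)}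

/-- There is at most one choice of action in every configuration. -/
def Deterministic (M : PDA α Q Γ) : Prop :=
  ∀ (c : Config α Q Γ) (x₁ y₁ x₂ y₂ : Option α) (c₁ c₂ : Config α Q Γ),
    M.StepBy x₁ y₁ c c₁ → M.StepBy x₂ y₂ c c₂ → x₁ = x₂ ∧ y₁ = y₂ ∧ c₁ = c₂

end PDA

/-! ### Language families

A language family assigns to each alphabet `α` a set of languages over `α`. -/

/-- Languages accepted by nondeterministic input-driven double-head pushdown automata
(with a single signature). -/
def NIDDHPDA (α : Type) : Set (Language α) :=
  {L | ∃ (Q Γ : Type) (_ : Finite Q) (_ : Finite Γ) (M : IDPDA α Q Γ),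
    M.SingleSignature ∧ M.language = L}

/-- Languages accepted by deterministic input-driven double-head pushdown automata
(with a single signature). -/
def DIDDHPDA (α : Type) : Set (Language α) :=
  {L | ∃ (Q Γ : Type) (_ : Finite Q) (_ : Finite Γ) (M : IDPDA α Q Γ),
    M.SingleSignature ∧ M.Deterministic ∧ M.language = L}

/-- Languages accepted by nondeterministic double input-driven double-head pushdown automata
(with two signatures). -/
def NDoIDDHPDA (α : Type) : Set (Language α) :=
  {L | ∃ (Q Γ : Type) (_ : Finite Q) (_ : Finite Γ) (M : IDPDA α Q Γ), M.language = L}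

/-- Languages accepted by deterministic double input-driven double-head pushdown automata
(with two signatures). -/
def DDoIDDHPDA (α : Type) : Set (Language α) :=
  {L | ∃ (Q Γ : Type) (_ : Finite Q) (_ : Finite Γ) (M : IDPDA α Q Γ),
    M.Deterministic ∧ M.language = L}

/-- Languages accepted by deterministic double-head pushdown automata, without the input-driven
restriction. -/
def DDHPDA (α : Type) : Set (Language α) :=
  {L | ∃ (Q Γ : Type) (_ : Finite Q) (_ : Finite Γ) (M : PDA α Q Γ),
    M.Deterministic ∧ M.language = L}

/-- Strict inclusion of language families over finite alphabets. -/
def StrictlyIncluded (F G : (α : Type) → Set (Language α)) : Prop :=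
  (∀ α : Type, Finite α → F α ⊆ G α) ∧ ∃ α : Type, Finite α ∧ ∃ L ∈ G α, L ∉ F α

/-! ### The witness language -/

/-- The alphabet of the witness language; `dl` and `dr` are the two center markers. -/
inductive Symb
  | a
  | b
  | c
  | dl
  | dr

/-- The language `{a^n b^n c^n $_l c^i b^j a^k} ∪ {a^i b^j c^k $_r c^n b^n a^n}`
with `i, j, k, n ≥ 0`. -/
def Ldta : Language Symb :=
  {w | ∃ i j k n : ℕ,
    w = List.replicate n .a ++ List.replicate n .b ++ List.replicate n .c ++ [.dl] ++
        List.replicate i .c ++ List.replicate j .b ++ List.replicate k .a ∨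
    w = List.replicate i .a ++ List.replicate j .b ++ List.replicate k .c ++ [.dr] ++
        List.replicate n .c ++ List.replicate n .b ++ List.replicate n .a}

end DoubleHead

namespace DoubleHead

/-! ### Pushdown systems and an interchange lemma -/

/-! A deterministic automaton cannot tell which marker `d` stands in the middle of `a^n b^n c^n d
c^n b^n a^n`; both choices give a word of the language. It makes the same steps on the two words
until one head has used up its half. So for every `n`, either the left head reads all of `a^n b^n
c^n` with `$_l` still unread, or the right head reads all of `c^n b^n a^n` with `$_r` still unread
(`leftReads_or_rightReads`). Interchanging the heads reduces the second case to the first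
(`RightReads.mirror`).

In the first case, keep only what the left head reads before the marker and guess everything else.
This gives an ordinary one-way pushdown system, `Guess`. It reads every such `a^n b^n c^n`
(`LeftReads.empties`), and each word `u` it reads extends to an accepted word with `u` in front of
`$_l` (`guessSound_of_empties`), so it reads nothing but words `a^n b^n c^n`. By an interchange
argument in the style of non-context-freeness proofs, it reads only finitely many of them
(`not_pops_abc`). Hence both cases fail for large `n`.

Input-driven automata are a special case of general ones (`toPDA`). For membership,
`Witness.automaton` guesses in its first step which head scans the unrestricted side; this is its
only nondeterministic choice. -/

/-- `Pops R p s q w`: starting in state `p`, the pushdown symbols `s` can be removed while the word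
`w` is read, and state `q` is reached. A step `R p z x p' γ` reads `x` and replaces `z` by `γ`. -/
inductive Pops {α P Z : Type} (R : P → Z → List α → P → List Z → Prop) :
    P → List Z → P → List α → Prop
  | nil (p : P) : Pops R p [] p []
  | cons {p p' r q : P} {z : Z} {s γ : List Z} {x u v : List α} :
      R p z x p' γ → Pops R p' γ r u → Pops R r s q v → Pops R p (z :: s) q (x ++ (u ++ v))

/-- The same relation as `Pops`, presented as a sequence of steps. -/
inductive Empties {α P Z : Type} (R : P → Z → List α → P → List Z → Prop) :
    P → List Z → P → List α → Prop
  | nil (p : P) : Empties R p [] p []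
  | step {p p' q : P} {z : Z} {s γ : List Z} {x u : List α} :
      R p z x p' γ → Empties R p' (γ ++ s) q u → Empties R p (z :: s) q (x ++ u)

section Interchange

variable {α P Z : Type} {R : P → Z → List α → P → List Z → Prop}

/-- The computation is cut at the moment when exactly `γ` has been removed. This turns step
sequences into the tree-like derivations in which factors can be exchanged. -/
theorem Pops.of_append {γ s : List Z} {p q : P} {w : List α} (h : Pops R p (γ ++ s) q w) :
    ∃ r u v, w = u ++ v ∧ Pops R p γ r u ∧ Pops R r s q v := by
  induction γ generalizing p w with
  | nil => exact ⟨p, [], w, rfl, .nil p, h⟩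
  | cons z γ ih =>
    cases h with
    | cons hR h₁ h₂ =>
      obtain ⟨r, u, v, rfl, hu, hv⟩ := ih h₂
      exact ⟨r, _, v, by simp, .cons hR h₁ hu, hv⟩

theorem Empties.pops {p q : P} {s : List Z} {w : List α} (h : Empties R p s q w) :
    Pops R p s q w := by
  induction h with
  | nil p => exact .nil p
  | step hR _ ih =>
    obtain ⟨r, u, v, rfl, hu, hv⟩ := ih.of_append
    exact .cons hR hu hv

theorem Pops.empties_append {p r : P} {γ : List Z} {u : List α} (h : Pops R p γ r u)
    {q : P} {s : List Z} {v : List α} (h' : Empties R r s q v) :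
    Empties R p (γ ++ s) q (u ++ v) := by
  induction h generalizing q s v with
  | nil p => exact h'
  | cons hR _ _ ih₁ ih₂ =>
    have := Empties.step hR (ih₁ (ih₂ h'))
    simpa using this

theorem Pops.empties {p q : P} {s : List Z} {w : List α} (h : Pops R p s q w) :
    Empties R p s q w := by
  simpa using h.empties_append (.nil q)

/-- Every sufficiently long word contains an exchangeable factor whose length lies
between `n` and `2 * n`. -/
theorem Pops.exists_factor {K : ℕ} (hK : ∀ p z x p' γ, R p z x p' γ → γ.length ≤ K)
    (hx : ∀ p z x p' γ, R p z x p' γ → x.length ≤ 1)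
    {p q : P} {s : List Z} {w : List α} (h : Pops R p s q w) (hs : s.length ≤ K)
    {n : ℕ} (hn : n ≤ w.length) :
    ∃ p' s' q' x w' y, s'.length ≤ K ∧ Pops R p' s' q' w' ∧ n ≤ w'.length ∧ w'.length ≤ 2 * n ∧
      w = x ++ w' ++ y ∧ ∀ w'', Pops R p' s' q' w'' → Pops R p s q (x ++ w'' ++ y) := by
  induction h with
  | nil p =>
    exact ⟨p, [], p, [], [], [], hs, .nil p, hn, by simp, rfl, fun w'' h => by simpa using h⟩
  | @cons p p' r q z s γ x u v hR h₁ h₂ ih₁ ih₂ =>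
    -- Descend in the derivation until the length first drops to at most `2 * n`. Above that point
    -- one of the two subderivations still reads at least `n` symbols.
    by_cases hle : (x ++ (u ++ v)).length ≤ 2 * n
    · exact ⟨p, z :: s, q, [], _, [], hs, .cons hR h₁ h₂, hn, hle, by simp,
        fun w'' h => by simpa using h⟩
    have h1 := hx _ _ _ _ _ hR
    simp only [List.length_append, List.length_cons] at hle hn hs
    by_cases hu : n ≤ u.length
    · obtain ⟨p₁, s₁, q₁, x₁, w₁, y₁, a₁, a₂, a₃, a₄, rfl, a₅⟩ := ih₁ (hK _ _ _ _ _ hR) hu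
      refine ⟨p₁, s₁, q₁, x ++ x₁, w₁, y₁ ++ v, a₁, a₂, a₃, a₄, by simp, fun w'' h => ?_⟩
      simpa using Pops.cons hR (a₅ w'' h) h₂
    -- More than `2 * n` symbols in total, at most one in `x` and fewer than `n` in `u` leave at
    -- least `n` for `v`.
    · obtain ⟨p₁, s₁, q₁, x₁, w₁, y₁, a₁, a₂, a₃, a₄, rfl, a₅⟩ := ih₂ (by omega) (by omega)
      refine ⟨p₁, s₁, q₁, x ++ u ++ x₁, w₁, y₁, a₁, a₂, a₃, a₄, by simp, fun w'' h => ?_⟩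
      simpa using Pops.cons hR h₁ (a₅ w'' h)

end Interchange

/-! ### The words `a^n b^n c^n` -/

/-- The word `a^n b^n c^n`. -/
def abc (n : ℕ) : List Symb :=
  List.replicate n .a ++ List.replicate n .b ++ List.replicate n .c

instance : DecidableEq Symb := fun x y => by
  cases x <;> cases y <;> first | exact isTrue rfl | exact isFalse (by simp)

instance : Finite Symb :=
  Finite.of_injective
    (fun s : Symb => match s with
      | .a => (0 : Fin 5) | .b => 1 | .c => 2 | .dl => 3 | .dr => 4)
    (by intro x y; cases x <;> cases y <;> simp)

theorem count_abc (n : ℕ) :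
    (abc n).count .a = n ∧ (abc n).count .b = n ∧ (abc n).count .c = n := by
  simp [abc, List.count_append, List.count_replicate]

theorem length_eq_of_mem_abc {w : List Symb} (h : ∀ x ∈ w, x = .a ∨ x = .b ∨ x = .c) :
    w.length = w.count .a + w.count .b + w.count .c := by
  induction w with
  | nil => rfl
  | cons x w ih =>
    have := ih fun y hy => h y (List.mem_cons_of_mem _ hy)
    rcases h x List.mem_cons_self with rfl | rfl | rfl <;> simp <;> omega

theorem mem_abc {n : ℕ} {x : Symb} (h : x ∈ abc n) : x = .a ∨ x = .b ∨ x = .c := by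
  simp only [abc, List.mem_append, List.mem_replicate] at h
  tauto

/-- The letters occur in sorted order, so a factor containing both an `a` and a `c` contains
everything in between. -/
theorem count_b_of_abc_eq {n : ℕ} {x w y : List Symb} (h : abc n = x ++ w ++ y)
    (ha : 0 < w.count .a) (hc : 0 < w.count .c) : w.count .b = n := by
  let rank : Symb → ℕ := fun s => match s with | .a => 0 | .b => 1 | _ => 2
  have hp : (abc n).Pairwise fun s t => rank s ≤ rank t := by
    simp only [abc, List.pairwise_append, List.pairwise_replicate, List.mem_append,
      List.mem_replicate]
    refine ⟨⟨.inr le_rfl, .inr le_rfl, ?_⟩, .inr le_rfl, ?_⟩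
    · rintro s ⟨-, rfl⟩ t ⟨-, rfl⟩; simp [rank]
    · rintro s (⟨-, rfl⟩ | ⟨-, rfl⟩) t ⟨-, rfl⟩ <;> simp [rank]
  rw [h] at hp
  simp only [List.pairwise_append, List.mem_append] at hp
  have hx : x.count .b = 0 := List.count_eq_zero.2 fun hb => by
    have := hp.1.2.2 _ hb _ (List.count_pos_iff.1 ha)
    simp [rank] at this
  have hy : y.count .b = 0 := List.count_eq_zero.2 fun hb => by
    have := hp.2.2 _ (.inr (List.count_pos_iff.1 hc)) _ hb
    simp [rank] at this
  have := (count_abc n).2.1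
  rw [h, List.count_append, List.count_append] at this
  omega

/-- A pushdown system with finitely many states and symbols that only reads words `a^n b^n c^n`
reads only finitely many of them. -/
theorem not_pops_abc {P Z : Type} [Finite P] [Finite Z]
    {R : P → Z → List Symb → P → List Z → Prop} {K : ℕ}
    (hK : ∀ p z x p' γ, R p z x p' γ → γ.length ≤ K)
    (hx : ∀ p z x p' γ, R p z x p' γ → x.length ≤ 1)
    {p q : P} {s : List Z} (hs : s.length ≤ K) (hsub : ∀ w, Pops R p s q w → ∃ n, w = abc n) :
    ∃ N, ∀ n ≥ N, ¬ Pops R p s q (abc n) := by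
  by_contra! hcon
  choose F hF hpops using hcon
  -- The exponents more than double at each step. This makes the larger factor longer than the
  -- smaller one, and it also drives the final length estimate.
  let g : ℕ → ℕ := fun i => Nat.rec (F 1) (fun _ m => F (2 * m + 1)) i
  have hg : ∀ i, Pops R p s q (abc (g i)) := by
    intro i
    cases i <;> exact hpops _
  have hsucc : ∀ i, 2 * g i < g (i + 1) := fun i => hF (2 * g i + 1)
  have hmono : Monotone g := monotone_nat_of_le_succ fun i => by have := hsucc i; omega
  have hlt : ∀ i j, i < j → 2 * g i < g j := fun i j hij =>
    (hsucc i).trans_le (hmono hij)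
  have key : ∀ i, ∃ t : P × {l : List Z // l.length ≤ K} × P, ∃ x w y : List Symb,
      Pops R t.1 t.2.1 t.2.2 w ∧ g i ≤ w.length ∧ w.length ≤ 2 * g i ∧ abc (g i) = x ++ w ++ y ∧
      ∀ w', Pops R t.1 t.2.1 t.2.2 w' → Pops R p s q (x ++ w' ++ y) := by
    intro i
    obtain ⟨p', s', q', x, w, y, h₁, h₂, h₃, h₄, h₅, h₆⟩ :=
      (hg i).exists_factor hK hx hs (n := g i) (by simp [abc])
    exact ⟨(p', ⟨s', h₁⟩, q'), x, w, y, h₂, h₃, h₄, h₅, h₆⟩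
  choose t x w y ht hlo hhi heq hex using key
  have : Finite {l : List Z // l.length ≤ K} := (List.finite_length_le Z K).to_subtype
  -- The stores `s'` have bounded length, so there are only finitely many triples and two exponents
  -- share one.
  obtain ⟨i, j, hij, htt⟩ : ∃ i j, i < j ∧ t i = t j := by
    obtain ⟨i, j, hne, h⟩ := Finite.exists_ne_map_eq_of_infinite t
    rcases hne.lt_or_gt with h' | h'
    exacts [⟨i, j, h', h⟩, ⟨j, i, h', h.symm⟩]
  obtain ⟨m, hm⟩ := hsub _ (hex i (w j) (htt ▸ ht j))
  have hbig := hlt i j hij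
  have hlen : ∀ i, (w i).length = (w i).count .a + (w i).count .b + (w i).count .c := fun i =>
    length_eq_of_mem_abc fun s hs => mem_abc (n := g i) (by rw [heq i]; simp [hs])
  have ci := count_abc (g i)
  have cm := count_abc m
  rw [heq i] at ci
  rw [← hm] at cm
  simp only [List.count_append] at ci cm
  have li := hlen i
  have lj := hlen j
  have := hlo i; have := hlo j; have := hhi i; have := hhi j
  -- Both `abc (g i)` and the exchanged word have equal letter counts, so `w j` exceeds `w i` by the
  -- same amount in each letter. The amount is positive because `w j` is longer, so `w j` contains
  -- `a` and `c`, hence all `g j` letters `b`. Its length is then at least `3 * g j - 2 * g i > 2 *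
  -- g j`, a contradiction.
  have hb := count_b_of_abc_eq (heq j) (by omega) (by omega)
  omega


/-! ### Runs of double-head pushdown automata -/

namespace PDA

variable {α Q Γ : Type}

/-- `M.Run q s u v q' s'`: there is a computation from state `q` and pushdown content `s` to `q'`
and `s'` in which the left head reads `u` and the right head reads `v` (written from left to
right). -/
inductive Run (M : PDA α Q Γ) : Q → List Γ → List α → List α → Q → List Γ → Prop
  | refl (q : Q) (s : List Γ) : Run M q s [] [] q s
  | head {q q' r : Q} {s γ t : List Γ} {x y : Option α} {u v : List α} :
      (q', γ) ∈ M.δ q x y s.head? → Run M q' (γ ++ s.tail) u v r t →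
      Run M q s (x.toList ++ u) (v ++ y.toList) r t

/-- `M.Accepts q w s`: an accepting computation starts in the configuration `(q, w, s)`. -/
def Accepts (M : PDA α Q Γ) (q : Q) (w : List α) (s : List Γ) : Prop :=
  ∃ q' ∈ M.accept, ∃ s' : List Γ, Relation.ReflTransGen M.Step (q, w, s) (q', [], s')

theorem Accepts.head {M : PDA α Q Γ} {q q' : Q} {x y : Option α} {w : List α} {s γ : List Γ}
    (hδ : (q', γ) ∈ M.δ q x y s.head?) (h : M.Accepts q' w (γ ++ s.tail)) :
    M.Accepts q (x.toList ++ w ++ y.toList) s := by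
  obtain ⟨r, hr, t, h⟩ := h
  exact ⟨r, hr, t, .head ⟨x, y, .mk hδ⟩ h⟩

theorem Accepts.induction {M : PDA α Q Γ} {motive : ∀ q w s, M.Accepts q w s → Prop}
    (refl : ∀ q (hq : q ∈ M.accept) s, motive q [] s ⟨q, hq, s, .refl⟩)
    (head : ∀ q q' x y w s γ (hδ : (q', γ) ∈ M.δ q x y s.head?)
      (h : M.Accepts q' w (γ ++ s.tail)), motive q' w (γ ++ s.tail) h →
      motive q (x.toList ++ w ++ y.toList) s (h.head hδ))
    {q : Q} {w : List α} {s : List Γ} (h : M.Accepts q w s) : motive q w s h := by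
  obtain ⟨r, hr, t, h⟩ := h
  suffices H : ∀ c : Config α Q Γ, ∀ hc : Relation.ReflTransGen M.Step c (r, [], t),
      motive c.1 c.2.1 c.2.2 ⟨r, hr, t, hc⟩ from H _ h
  intro c hc
  induction hc using Relation.ReflTransGen.head_induction_on with
  | refl => exact refl r hr t
  | head hstep hrest ih =>
    obtain ⟨x, y, hstep⟩ := hstep
    cases hstep with
    | mk hδ => exact head _ _ _ _ _ _ _ hδ ⟨r, hr, t, hrest⟩ ih

/-! ### Computations up to the marker -/

/-- The left head can read the whole of `u` before `d` is read, in a computation that can be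
continued to an accepting one. -/
def LeftReads (M : PDA α Q Γ) (d : α) (q : Q) (s : List Γ) (u v : List α) : Prop :=
  ∃ q' s' v₁ v₂, v = v₁ ++ v₂ ∧ M.Run q s u v₂ q' s' ∧ M.Accepts q' (d :: v₁) s'

/-- The right head can read the whole of `v` before `d` is read, in a computation that can be
continued to an accepting one. -/
def RightReads (M : PDA α Q Γ) (d : α) (q : Q) (s : List Γ) (u v : List α) : Prop :=
  ∃ q' s' u₁ u₂, u = u₁ ++ u₂ ∧ M.Run q s u₁ v q' s' ∧ M.Accepts q' (u₂ ++ [d]) s'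

theorem LeftReads.head {M : PDA α Q Γ} {d : α} {q q' : Q} {x y : Option α} {s γ : List Γ}
    {u v : List α} (hδ : (q', γ) ∈ M.δ q x y s.head?) (h : M.LeftReads d q' (γ ++ s.tail) u v) :
    M.LeftReads d q s (x.toList ++ u) (v ++ y.toList) := by
  obtain ⟨r, t, v₁, v₂, rfl, hr, ha⟩ := h
  exact ⟨r, t, v₁, v₂ ++ y.toList, by simp, .head hδ hr, ha⟩

theorem RightReads.head {M : PDA α Q Γ} {d : α} {q q' : Q} {x y : Option α} {s γ : List Γ}
    {u v : List α} (hδ : (q', γ) ∈ M.δ q x y s.head?) (h : M.RightReads d q' (γ ++ s.tail) u v) :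
    M.RightReads d q s (x.toList ++ u) (v ++ y.toList) := by
  obtain ⟨r, t, u₁, u₂, rfl, hr, ha⟩ := h
  exact ⟨r, t, x.toList ++ u₁, u₂, by simp, .head hδ hr, ha⟩

/-- A step on `u d v` with nonempty `u` and `v` does not touch the symbol `d` between them. -/
theorem split_of_append_eq {a b d : α} {u v w : List α} {x y : Option α}
    (h : a :: u ++ d :: (v ++ [b]) = x.toList ++ w ++ y.toList) :
    ∃ u' v', a :: u = x.toList ++ u' ∧ v ++ [b] = v' ++ y.toList ∧ w = u' ++ d :: v' := by
  have hy : ∀ l : List α, l ++ d :: (v ++ [b]) = w ++ y.toList →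
      ∃ v', v ++ [b] = v' ++ y.toList ∧ w = l ++ d :: v' := by
    intro l hl
    cases y with
    | none => exact ⟨v ++ [b], by simp, by simpa using hl.symm⟩
    | some b' =>
      have : (l ++ d :: v) ++ [b] = w ++ [b'] := by simpa using hl
      obtain ⟨h₁, h₂⟩ := List.append_inj' this rfl
      exact ⟨v, by simpa using h₂, h₁.symm⟩
  cases x with
  | none =>
    obtain ⟨v', h₁, h₂⟩ := hy (a :: u) (by simpa using h)
    exact ⟨a :: u, v', rfl, h₁, h₂⟩
  | some a' =>
    simp only [Option.toList_some, List.cons_append, List.nil_append, List.cons.injEq] at h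
    obtain ⟨v', h₁, h₂⟩ := hy u h.2
    exact ⟨u, v', by simp [h.1], h₁, h₂⟩

/-- As long as it does not read the symbol in between `u` and `v`, a deterministic automaton behaves
in the same way whether this symbol is `d` or `e`. -/
theorem Deterministic.leftReads_or_rightReads {M : PDA α Q Γ} (hM : M.Deterministic) {d e : α}
    {q : Q} {s : List Γ} {u v : List α} (hd : M.Accepts q (u ++ d :: v) s)
    (he : M.Accepts q (u ++ e :: v) s) : M.LeftReads d q s u v ∨ M.RightReads e q s u v := by
  generalize hw : u ++ d :: v = w at hd
  induction hd using Accepts.induction generalizing u v with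
  | refl => simp at hw
  | head q q' x y w s γ hδ hacc ih =>
    rcases u with _ | ⟨a, u⟩
    · left
      refine ⟨q, s, v, [], by simp, .refl q s, ?_⟩
      have : d :: v = x.toList ++ w ++ y.toList := hw
      rw [this]
      exact hacc.head hδ
    rcases List.eq_nil_or_concat' v with rfl | ⟨v, b, rfl⟩
    · exact .inr ⟨q, s, [], _, rfl, .refl q s, he⟩
    obtain ⟨u', v', hu, hv, rfl⟩ := split_of_append_eq hw
    generalize hw' : a :: u ++ e :: (v ++ [b]) = w' at he
    obtain ⟨r, hr, t, hrun⟩ := he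
    rcases Relation.ReflTransGen.cases_head hrun with h | ⟨c, ⟨x', y', hstep⟩, hrest⟩
    · simp [← hw'] at h
    have hs : M.StepBy x y (q, w', s) (q', u' ++ e :: v', γ ++ s.tail) := by
      have : w' = x.toList ++ (u' ++ e :: v') ++ y.toList := by
        rw [← hw', hu, hv]; simp
      rw [this]
      exact .mk hδ
    obtain ⟨-, -, rfl⟩ := hM _ _ _ _ _ _ _ hs hstep
    rw [hu, hv]
    exact (ih ⟨r, hr, t, hrest⟩ rfl).imp (.head hδ) (.head hδ)

/-! ### Interchanging the two heads -/

/-- The automaton `M` with its two heads interchanged. -/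
def mirror (M : PDA α Q Γ) : PDA α Q Γ where
  start := M.start
  accept := M.accept
  δ q x y z := M.δ q y x z

theorem reverse_toList (x : Option α) : x.toList.reverse = x.toList := by
  cases x <;> rfl

theorem Accepts.mirror {M : PDA α Q Γ} {q : Q} {w : List α} {s : List Γ} (h : M.Accepts q w s) :
    M.mirror.Accepts q w.reverse s := by
  induction h using Accepts.induction with
  | refl q hq s => exact ⟨q, hq, s, .refl⟩
  | head q q' x y w s γ hδ hacc ih =>
    have := ih.head (M := M.mirror) (q := q) (x := y) (y := x) hδ
    simpa [reverse_toList] using this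

theorem Run.mirror {M : PDA α Q Γ} {q r : Q} {s t : List Γ} {u v : List α}
    (h : M.Run q s u v r t) : M.mirror.Run q s v.reverse u.reverse r t := by
  induction h with
  | refl q s => exact .refl q s
  | @head q q' r s γ t x y u v hδ _ ih =>
    have := Run.head (M := M.mirror) (q := q) (x := y) (y := x) hδ ih
    simpa [reverse_toList] using this

theorem RightReads.mirror {M : PDA α Q Γ} {d : α} {q : Q} {s : List Γ} {u v : List α}
    (h : M.RightReads d q s u v) : M.mirror.LeftReads d q s v.reverse u.reverse := by
  obtain ⟨r, t, u₁, u₂, rfl, hr, ha⟩ := h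
  exact ⟨r, t, u₂.reverse, u₁.reverse, by simp, hr.mirror, by simpa using ha.mirror⟩

/-! ### Guessing the symbols read by the right head -/

/-- The states of a one-way pushdown system that reads what the left head reads up to a marker and
guesses everything else: before the marker is read, after it is read, after it is read as the
last symbol of the input, and emptying the store at the end. -/
abbrev Phase (Q : Type) : Type := Q ⊕ Q ⊕ Q ⊕ Unit

/-- The pushdown content `s` on top of a bottom symbol. -/
def withBottom (s : List Γ) : List (Option Γ) := s.map some ++ [none]

/-- The word that replaces the top symbol `z` if `γ` is pushed instead of it. -/
def replaceTop (γ : List Γ) (z : Option Γ) : List (Option Γ) :=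
  γ.map some ++ if z.isNone then [none] else []

/-- The top symbol is always `s.head?`, so `Guess` sees what `M` sees, even on an empty store. In
that case the bottom symbol itself is consumed, and `replaceTop` puts it back. -/
theorem withBottom_eq (s : List Γ) :
    withBottom s = s.head? :: if s = [] then [] else withBottom s.tail := by
  cases s <;> simp [withBottom]

theorem replaceTop_append (s γ : List Γ) :
    replaceTop γ s.head? ++ (if s = [] then [] else withBottom s.tail) =
      withBottom (γ ++ s.tail) := by
  cases s <;> simp [withBottom, replaceTop]

/-- The steps of the one-way pushdown system. -/
inductive Guess (M : PDA α Q Γ) (d : α) :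
    Phase Q → Option Γ → List α → Phase Q → List (Option Γ) → Prop
  | before {q q' x y z γ} : (q', γ) ∈ M.δ q x y z →
      Guess M d (.inl q) z x.toList (.inl q') (replaceTop γ z)
  | left {q q' y z γ} : (q', γ) ∈ M.δ q (some d) y z →
      Guess M d (.inl q) z [] (.inr (.inl q')) (replaceTop γ z)
  | right {q q' z γ} : (q', γ) ∈ M.δ q none (some d) z →
      Guess M d (.inl q) z [] (.inr (.inr (.inl q'))) (replaceTop γ z)
  | after {q q' x y z γ} : (q', γ) ∈ M.δ q x y z →
      Guess M d (.inr (.inl q)) z [] (.inr (.inl q')) (replaceTop γ z)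
  | empty {q q' z γ} : (q', γ) ∈ M.δ q none none z →
      Guess M d (.inr (.inr (.inl q))) z [] (.inr (.inr (.inl q'))) (replaceTop γ z)
  | acceptAfter {q z} : q ∈ M.accept → Guess M d (.inr (.inl q)) z [] (.inr (.inr (.inr ()))) []
  | acceptEmpty {q z} : q ∈ M.accept →
      Guess M d (.inr (.inr (.inl q))) z [] (.inr (.inr (.inr ()))) []
  | pop {z} : Guess M d (.inr (.inr (.inr ()))) z [] (.inr (.inr (.inr ()))) []

/-- The states of `Guess` in which the rest of the store is emptied. -/
abbrev Phase.final : Phase Q := .inr (.inr (.inr ()))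

theorem Guess.length_le_one {M : PDA α Q Γ} {d : α} {p p' : Phase Q} {z : Option Γ} {x : List α}
    {γ : List (Option Γ)} (h : M.Guess d p z x p' γ) : x.length ≤ 1 := by
  cases h <;> simp

theorem exists_guess_bound [Finite α] [Finite Q] [Finite Γ] (M : PDA α Q Γ) (d : α) :
    ∃ K, 1 ≤ K ∧ ∀ p z x p' γ, M.Guess d p z x p' γ → γ.length ≤ K := by
  have hfin : (⋃ i : Q × Option α × Option α × Option Γ,
      (fun p : Q × List Γ => p.2.length) '' (M.δ i.1 i.2.1 i.2.2.1 i.2.2.2 : Set _)).Finite :=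
    Set.finite_iUnion fun i => (Finset.finite_toSet _).image _
  obtain ⟨K, hK⟩ := hfin.bddAbove
  have hδ : ∀ q x y z q' γ, (q', γ) ∈ M.δ q x y z → (replaceTop γ z).length ≤ K + 1 := by
    intro q x y z q' γ h
    have h₁ : γ.length ≤ K := hK (Set.mem_iUnion.2 ⟨(q, x, y, z), (q', γ), h, rfl⟩)
    have h₂ : (if z.isNone then [none] else [] : List (Option Γ)).length ≤ 1 := by
      split <;> simp
    simp only [replaceTop, List.length_append, List.length_map]
    omega
  -- The extra unit pays for a restored bottom symbol and also covers the initial store, which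
  -- consists of the bottom symbol alone.
  refine ⟨K + 1, by omega, fun p z x p' γ h => ?_⟩
  cases h with
  | acceptAfter | acceptEmpty | pop => simp
  | _ h => exact hδ _ _ _ _ _ _ h

section Simulation

variable {M : PDA α Q Γ} {d : α}

theorem empties_final (s : List (Option Γ)) :
    Empties (M.Guess d) Phase.final s Phase.final [] := by
  induction s with
  | nil => exact .nil _
  | cons z s ih => exact .step (x := []) (γ := []) .pop ih

theorem empties_step {p p' : Phase Q} {s γ : List Γ} {x u : List α}
    (h : M.Guess d p s.head? x p' (replaceTop γ s.head?))
    (h' : Empties (M.Guess d) p' (withBottom (γ ++ s.tail)) Phase.final u) :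
    Empties (M.Guess d) p (withBottom s) Phase.final (x ++ u) := by
  rw [← replaceTop_append] at h'
  rw [withBottom_eq]
  exact .step h h'

/-- Nothing is left to read, so only steps moving no head remain. Guessing symbols in this phase
would be unsound: the right head has read `d`, so they would stand to the left of `d`. -/
theorem Accepts.empties_empty {q : Q} {w : List α} {s : List Γ} (h : M.Accepts q w s)
    (hw : w = []) :
    Empties (M.Guess d) (.inr (.inr (.inl q))) (withBottom s) Phase.final [] := by
  induction h using Accepts.induction with
  | refl q hq s => rw [withBottom_eq]; exact .step (.acceptEmpty hq) (empties_final _)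
  | head q q' x y w s γ hδ _ ih =>
    cases x <;> cases y <;> simp at hw
    exact empties_step (.empty hδ) (ih hw)

theorem Accepts.empties_after {q : Q} {w : List α} {s : List Γ} (h : M.Accepts q w s) :
    Empties (M.Guess d) (.inr (.inl q)) (withBottom s) Phase.final [] := by
  induction h using Accepts.induction with
  | refl q hq s => rw [withBottom_eq]; exact .step (.acceptAfter hq) (empties_final _)
  | head q q' x y w s γ hδ _ ih => exact empties_step (.after hδ) ih

theorem Accepts.empties_before {q : Q} {w v : List α} {s : List Γ} (h : M.Accepts q w s)
    (hw : w = d :: v) :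
    Empties (M.Guess d) (.inl q) (withBottom s) Phase.final [] := by
  induction h using Accepts.induction generalizing v with
  | refl => simp at hw
  | head q q' x y w s γ hδ hacc ih =>
    cases x with
    | some a =>
      simp only [Option.toList_some, List.cons_append, List.nil_append, List.cons.injEq] at hw
      obtain ⟨rfl, -⟩ := hw
      exact empties_step (.left hδ) hacc.empties_after
    | none =>
      cases w with
      | cons a w =>
        simp only [Option.toList_none, List.cons_append, List.nil_append, List.cons.injEq] at hw
        obtain ⟨rfl, -⟩ := hw
        exact empties_step (.before hδ) (ih rfl)
      | nil =>
        cases y with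
        | none => simp at hw
        | some b =>
          simp only [Option.toList_none, Option.toList_some, List.nil_append,
            List.cons.injEq] at hw
          obtain ⟨rfl, -⟩ := hw
          exact empties_step (.right hδ) (hacc.empties_empty rfl)

theorem LeftReads.empties {q : Q} {s : List Γ} {u v : List α} (h : M.LeftReads d q s u v) :
    Empties (M.Guess d) (.inl q) (withBottom s) Phase.final u := by
  obtain ⟨r, t, v₁, v₂, -, hr, ha⟩ := h
  clear v
  induction hr with
  | refl => exact ha.empties_before rfl
  | head hδ _ ih => exact empties_step (.before hδ) (ih ha)

/-- What a computation of `Guess` that reads `u` means for the automaton `M`. -/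
def GuessSound (M : PDA α Q Γ) (d : α) (S : List (Option Γ)) (u : List α) : Phase Q → Prop
  | .inl q => ∀ s, S = withBottom s → ∃ v, M.Accepts q (u ++ d :: v) s
  | .inr (.inl q) => u = [] ∧ ∀ s, S = withBottom s → ∃ v, M.Accepts q v s
  | .inr (.inr (.inl q)) => u = [] ∧ ∀ s, S = withBottom s → M.Accepts q [] s
  | .inr (.inr (.inr _)) => u = []

theorem guessSound_of_empties {p p' : Phase Q} {S : List (Option Γ)} {u : List α}
    (h : Empties (M.Guess d) p S p' u) (hp : p' = Phase.final) : M.GuessSound d S u p := by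
  induction h with
  | nil p => subst hp; rfl
  | @step p p' q z S γ x u hR _ ih =>
    replace ih := ih hp
    have key : ∀ s, z :: S = withBottom s → z = s.head? ∧ ∀ γ : List Γ,
        replaceTop γ z ++ S = withBottom (γ ++ s.tail) := by
      intro s hs
      rw [withBottom_eq, List.cons.injEq] at hs
      obtain ⟨rfl, rfl⟩ := hs
      exact ⟨rfl, replaceTop_append s⟩
    cases hR with
    | @before q q' x y _ γ hδ =>
      intro s hs
      obtain ⟨rfl, hs⟩ := key s hs
      obtain ⟨v, hv⟩ := ih _ (hs γ)
      -- A guessed symbol of the right head stands to the right of all symbols guessed later.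
      exact ⟨v ++ y.toList, by simpa using hv.head hδ⟩
    | @left q q' y _ γ hδ =>
      intro s hs
      obtain ⟨rfl, hs⟩ := key s hs
      obtain ⟨rfl, ih⟩ := ih
      obtain ⟨v, hv⟩ := ih _ (hs γ)
      exact ⟨v ++ y.toList, by simpa using hv.head hδ⟩
    | @right q q' _ γ hδ =>
      intro s hs
      obtain ⟨rfl, hs⟩ := key s hs
      obtain ⟨rfl, ih⟩ := ih
      exact ⟨[], by simpa using (ih _ (hs γ)).head hδ⟩
    | @after q q' x y _ γ hδ =>
      obtain ⟨rfl, ih⟩ := ih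
      refine ⟨rfl, fun s hs => ?_⟩
      obtain ⟨rfl, hs⟩ := key s hs
      obtain ⟨v, hv⟩ := ih _ (hs γ)
      exact ⟨_, hv.head hδ⟩
    | @empty q q' _ γ hδ =>
      obtain ⟨rfl, ih⟩ := ih
      refine ⟨rfl, fun s hs => ?_⟩
      obtain ⟨rfl, hs⟩ := key s hs
      exact (ih _ (hs γ)).head hδ
    | acceptAfter hq =>
      obtain rfl : u = [] := ih
      exact ⟨rfl, fun s _ => ⟨[], _, hq, s, .refl⟩⟩
    | acceptEmpty hq =>
      obtain rfl : u = [] := ih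
      exact ⟨rfl, fun s _ => ⟨_, hq, s, .refl⟩⟩
    | pop =>
      obtain rfl : u = [] := ih
      rfl

end Simulation

/-- If `u d v` is accepted only for words `u = a^n b^n c^n`, then the left head can read the whole
of `a^n b^n c^n` before `d` is read for finitely many `n` only. -/
theorem not_leftReads_abc [Finite Q] [Finite Γ] {M : PDA Symb Q Γ} {d : Symb}
    (hM : ∀ u v, u ++ d :: v ∈ M.language → ∃ n, u = abc n) :
    ∃ N, ∀ n ≥ N, ∀ v, ¬ M.LeftReads d M.start [] (abc n) v := by
  obtain ⟨K, hK₁, hK⟩ := M.exists_guess_bound d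
  obtain ⟨N, hN⟩ := not_pops_abc (R := M.Guess d) hK (fun _ _ _ _ _ h => h.length_le_one)
    (p := .inl M.start) (q := Phase.final) (s := withBottom []) hK₁ fun w hw => by
      obtain ⟨v, hv⟩ := guessSound_of_empties hw.empties rfl [] rfl
      exact hM w v hv
  exact ⟨N, fun n hn v h => hN n hn h.empties.pops⟩

end PDA

/-! ### Words of the language around a marker -/

theorem eq_abc_of_mem_Ldta {u v : List Symb} (h : u ++ .dl :: v ∈ Ldta) : ∃ n, u = abc n := by
  obtain ⟨i, j, k, n, h | h⟩ := h
  · refine ⟨n, ?_⟩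
    have h' : u ++ .dl :: v = abc n ++ .dl :: (List.replicate i .c ++ List.replicate j .b ++
        List.replicate k .a) := by simpa [abc] using h
    rw [List.append_eq_append_iff] at h'
    rcases h' with ⟨l, h₁, h₂⟩ | ⟨l, h₁, h₂⟩
    · cases l with
      | nil => simpa using h₁.symm
      | cons x l =>
        simp only [List.cons_append, List.cons.injEq] at h₂
        have := mem_abc (n := n) (x := x) (by simp [h₁])
        simp [← h₂.1] at this
    · cases l with
      | nil => simpa using h₁
      | cons x l =>
        simp only [List.cons_append, List.cons.injEq] at h₂
        have : Symb.dl ∈ l ++ Symb.dl :: v := by simp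
        rw [← h₂.2] at this
        simp at this
  · have : Symb.dl ∈ u ++ Symb.dl :: v := by simp
    rw [h] at this
    simp at this

theorem reverse_eq_abc_of_mem_Ldta {u v : List Symb} (h : u ++ .dr :: v ∈ Ldta) :
    ∃ n, v.reverse = abc n := by
  -- Reversing a word and swapping the two markers maps the language to itself.
  let f : Symb → Symb := fun s => match s with
    | .dl => .dr | .dr => .dl | s => s
  have hf : Function.Injective f := by
    intro x y; cases x <;> cases y <;> simp [f]
  have h' : (v.reverse.map f) ++ .dl :: (u.reverse.map f) ∈ Ldta := by
    have hm : v.reverse.map f ++ .dl :: u.reverse.map f = ((u ++ .dr :: v).reverse).map f := by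
      simp [f]
    rw [hm]
    obtain ⟨i, j, k, n, h | h⟩ := h
    · exact ⟨k, j, i, n, .inr (by rw [h]; simp [f])⟩
    · exact ⟨k, j, i, n, .inl (by rw [h]; simp [f])⟩
  obtain ⟨n, hn⟩ := eq_abc_of_mem_Ldta h'
  refine ⟨n, List.map_injective_iff.2 hf ?_⟩
  rw [hn]
  simp [abc, f]

/-- The witness language is not accepted by any deterministic double-head pushdown automaton. -/
theorem Ldta_notMem_DDHPDA : Ldta ∉ DDHPDA Symb := by
  rintro ⟨Q, Γ, _, _, M, hdet, hL⟩
  obtain ⟨N₁, h₁⟩ := M.not_leftReads_abc (d := .dl) fun u v h => eq_abc_of_mem_Ldta (hL ▸ h)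
  obtain ⟨N₂, h₂⟩ := M.mirror.not_leftReads_abc (d := .dr) fun u v h => by
    have h' : M.mirror.mirror.Accepts M.start (u ++ .dr :: v).reverse [] :=
      PDA.Accepts.mirror h
    have h'' : v.reverse ++ .dr :: u.reverse ∈ M.language := by
      have e : (u ++ .dr :: v).reverse = v.reverse ++ .dr :: u.reverse := by simp
      rw [← e]
      -- Interchanging the heads twice gives back `M` definitionally.
      exact h'
    obtain ⟨n, hn⟩ := reverse_eq_abc_of_mem_Ldta (hL ▸ h'')
    exact ⟨n, by rw [← hn, List.reverse_reverse]⟩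
  let n := max N₁ N₂
  have hmem : ∀ d, d = .dl ∨ d = .dr →
      M.Accepts M.start (abc n ++ d :: (abc n).reverse) [] := by
    intro d hd
    suffices H : abc n ++ d :: (abc n).reverse ∈ M.language from H
    rw [hL]
    refine ⟨n, n, n, n, hd.imp ?_ ?_⟩ <;> rintro rfl <;> simp [abc]
  rcases hdet.leftReads_or_rightReads (hmem .dl (.inl rfl)) (hmem .dr (.inr rfl)) with h | h
  · exact h₁ n (le_max_left _ _) _ h
  · exact h₂ n (le_max_right _ _) _ (by
      have h' := h.mirror
      rwa [List.reverse_reverse] at h')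


/-! ### Input-driven automata as double-head pushdown automata -/

namespace IDPDA

variable {α Q Γ : Type}

/-- The actions of the head `h`, as replacements of the top of the pushdown store. -/
def actions (M : IDPDA α Q Γ) (q : Q) (h : Head) (a : α) (z : Option Γ) : Set (Q × List Γ) :=
  match M.sig h a with
  | .push => (fun p : Q × Γ => (p.1, p.2 :: z.toList)) '' M.pushδ q h a z
  | .pop => (fun p : Q => (p, [])) '' M.popδ q h a z
  | .skip => (fun p : Q => (p, z.toList)) '' M.skipδ q h a z

theorem finite_actions [Finite Q] [Finite Γ] (M : IDPDA α Q Γ) (q : Q) (h : Head) (a : α)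
    (z : Option Γ) : (M.actions q h a z).Finite := by
  unfold actions
  split <;> exact (Set.toFinite _).image _

theorem stepBy_iff (M : IDPDA α Q Γ) {h : Head} {c c' : Config α Q Γ} :
    M.StepBy h c c' ↔ ∃ q a w s q' γ, (q', γ) ∈ M.actions q h a s.head? ∧
      c = (q, h.attach a w, s) ∧ c' = (q', w, γ ++ s.tail) := by
  have htop : ∀ s : List Γ, s.head?.toList ++ s.tail = s := by intro s; cases s <;> rfl
  constructor
  · rintro (⟨hs, hd⟩ | ⟨hs, hd⟩ | ⟨hs, hd⟩)
    · exact ⟨_, _, _, _, _, _, by rw [actions, hs]; exact ⟨_, hd, rfl⟩, rfl, by simp [htop]⟩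
    · exact ⟨_, _, _, _, _, _, by rw [actions, hs]; exact ⟨_, hd, rfl⟩, rfl, by simp⟩
    · exact ⟨_, _, _, _, _, _, by rw [actions, hs]; exact ⟨_, hd, rfl⟩, rfl, by simp [htop]⟩
  · rintro ⟨q, a, w, s, q', γ, hact, rfl, rfl⟩
    unfold actions at hact
    split at hact
    · obtain ⟨p, hp, he⟩ := hact
      simp only [Prod.mk.injEq] at he
      obtain ⟨rfl, rfl⟩ := he
      simpa [htop] using StepBy.push (by assumption) hp
    · obtain ⟨p, hp, he⟩ := hact
      simp only [Prod.mk.injEq] at he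
      obtain ⟨rfl, rfl⟩ := he
      exact StepBy.pop (by assumption) hp
    · obtain ⟨p, hp, he⟩ := hact
      simp only [Prod.mk.injEq] at he
      obtain ⟨rfl, rfl⟩ := he
      simpa [htop] using StepBy.skip (by assumption) hp

/-- An input-driven automaton as an automaton without the input-driven restriction. -/
noncomputable def toPDA [Finite Q] [Finite Γ] (M : IDPDA α Q Γ) : PDA α Q Γ where
  start := M.start
  accept := M.accept
  δ q x y z :=
    match x, y with
    | some a, none => (M.finite_actions q .left a z).toFinset
    | none, some a => (M.finite_actions q .right a z).toFinset
    | _, _ => ∅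

theorem toPDA_stepBy_iff [Finite Q] [Finite Γ] (M : IDPDA α Q Γ) {x y : Option α}
    {c c' : Config α Q Γ} :
    M.toPDA.StepBy x y c c' ↔ ∃ h q a w s q' γ, (q', γ) ∈ M.actions q h a s.head? ∧
      c = (q, h.attach a w, s) ∧ c' = (q', w, γ ++ s.tail) ∧
      (x, y) = (match h with | .left => (some a, none) | .right => (none, some a)) := by
  constructor
  · rintro ⟨hδ⟩
    rename_i q q' w s γ
    cases x <;> cases y <;> simp only [toPDA, Finset.notMem_empty, Set.Finite.mem_toFinset] at hδ
    · exact ⟨.right, q, _, w, s, q', γ, hδ, by simp [Head.attach], rfl, rfl⟩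
    · exact ⟨.left, q, _, w, s, q', γ, hδ, by simp [Head.attach], rfl, rfl⟩
  · rintro ⟨h, q, a, w, s, q', γ, hact, rfl, rfl, hxy⟩
    cases h <;> simp only [Prod.mk.injEq] at hxy <;> obtain ⟨rfl, rfl⟩ := hxy
    · have := PDA.StepBy.mk (M := M.toPDA) (x := some a) (y := none) (q := q) (q' := q')
        (w := w) (s := s) (γ := γ) (by simpa [toPDA] using hact)
      simpa [Head.attach] using this
    · have := PDA.StepBy.mk (M := M.toPDA) (x := none) (y := some a) (q := q) (q' := q')
        (w := w) (s := s) (γ := γ) (by simpa [toPDA] using hact)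
      simpa [Head.attach] using this

theorem toPDA_step [Finite Q] [Finite Γ] (M : IDPDA α Q Γ) : M.toPDA.Step = M.Step := by
  ext c c'
  simp only [PDA.Step, Step, toPDA_stepBy_iff, stepBy_iff]
  constructor
  · rintro ⟨x, y, h, q, a, w, s, q', γ, h₁, h₂, h₃, -⟩
    exact ⟨h, q, a, w, s, q', γ, h₁, h₂, h₃⟩
  · rintro ⟨h, q, a, w, s, q', γ, h₁, h₂, h₃⟩
    exact ⟨_, _, h, q, a, w, s, q', γ, h₁, h₂, h₃, rfl⟩

theorem Deterministic.toPDA [Finite Q] [Finite Γ] {M : IDPDA α Q Γ} (hM : M.Deterministic) :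
    M.toPDA.Deterministic := by
  intro c x₁ y₁ x₂ y₂ c₁ c₂ h₁ h₂
  obtain ⟨h, q, a, w, s, q', γ, hact, rfl, rfl, hxy⟩ := M.toPDA_stepBy_iff.1 h₁
  obtain ⟨h', r, b, w', s', r', γ', hact', hc, rfl, hxy'⟩ := M.toPDA_stepBy_iff.1 h₂
  obtain ⟨rfl, hcc⟩ := hM _ _ _ _ _ (M.stepBy_iff.2 ⟨q, a, w, s, q', γ, hact, rfl, rfl⟩)
    (M.stepBy_iff.2 ⟨r, b, w', s', r', γ', hact', hc, rfl⟩)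
  -- The same head reads from the same unread input, so it reads the same symbol.
  have hab : a = b := by
    cases h <;> simp [Head.attach] at hc <;> simp [hc]
  subst hab
  simp only [← hxy', Prod.mk.injEq] at hxy
  exact ⟨hxy.1, hxy.2, hcc⟩

end IDPDA

/-! ### Inclusions between the families -/

theorem DDoIDDHPDA_subset_DDHPDA (α : Type) : DDoIDDHPDA α ⊆ DDHPDA α := by
  rintro L ⟨Q, Γ, _, _, M, hdet, rfl⟩
  refine ⟨Q, Γ, ‹_›, ‹_›, M.toPDA, hdet.toPDA, ?_⟩
  simp only [PDA.language, IDPDA.language, IDPDA.toPDA_step]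
  rfl

theorem DIDDHPDA_subset_DDoIDDHPDA (α : Type) : DIDDHPDA α ⊆ DDoIDDHPDA α := by
  rintro L ⟨Q, Γ, _, _, M, -, hdet, hL⟩
  exact ⟨Q, Γ, ‹_›, ‹_›, M, hdet, hL⟩

theorem DIDDHPDA_subset_NIDDHPDA (α : Type) : DIDDHPDA α ⊆ NIDDHPDA α := by
  rintro L ⟨Q, Γ, _, _, M, hsig, -, hL⟩
  exact ⟨Q, Γ, ‹_›, ‹_›, M, hsig, hL⟩

theorem DDoIDDHPDA_subset_NDoIDDHPDA (α : Type) : DDoIDDHPDA α ⊆ NDoIDDHPDA α := by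
  rintro L ⟨Q, Γ, _, _, M, -, hL⟩
  exact ⟨Q, Γ, ‹_›, ‹_›, M, hL⟩

theorem NIDDHPDA_subset_NDoIDDHPDA (α : Type) : NIDDHPDA α ⊆ NDoIDDHPDA α := by
  rintro L ⟨Q, Γ, _, _, M, -, hL⟩
  exact ⟨Q, Γ, ‹_›, ‹_›, M, hL⟩


/-! ### A nondeterministic input-driven automaton for the witness language -/

/-- The other head. -/
def Head.flip : Head → Head
  | .left => .right
  | .right => .left

/-- The word `w`, read in such a direction that `f` is the right head. -/
def Head.orient {α : Type} : Head → List α → List α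
  | .left, w => w.reverse
  | .right, w => w

@[simp] theorem Head.orient_orient {α : Type} (f : Head) (w : List α) :
    f.orient (f.orient w) = w := by
  cases f <;> simp [orient]

@[simp] theorem Head.orient_attach {α : Type} (f : Head) (x : α) (w : List α) :
    f.orient (f.attach x w) = f.orient w ++ [x] := by
  cases f <;> simp [orient, attach]

@[simp] theorem Head.orient_attach_flip {α : Type} (f : Head) (x : α) (w : List α) :
    f.orient (f.flip.attach x w) = x :: f.orient w := by
  cases f <;> simp [orient, attach, flip]

@[simp] theorem Head.orient_nil {α : Type} (f : Head) : f.orient ([] : List α) = [] := by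
  cases f <;> rfl

namespace Witness

/-- The stages of the computation: one head reads a word from `a* b* c*` up to the marker, then the
letters `a` at the one end are pushed and matched with the letters `c` at the other end, then
the letters `b` are matched with the pushdown content. -/
inductive Stage
  | scanA
  | scanB
  | scanC
  | marked
  | owing
  | balanced
  | popping
  | done

/-- A state is either initial or consists of the head that reads the marker and a stage. -/
abbrev State : Type := Option (Head × Stage)

instance : Finite Head :=
  Finite.of_injective (fun h : Head => match h with | .left => true | .right => false)
    (by intro x y; cases x <;> cases y <;> simp)

instance : Finite Stage :=
  Finite.of_injective
    (fun t : Stage => match t with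
      | .scanA => (0 : Fin 8) | .scanB => 1 | .scanC => 2 | .marked => 3
      | .owing => 4 | .balanced => 5 | .popping => 6 | .done => 7)
    (by intro x y; cases x <;> cases y <;> simp)

/-- The marker next to which the language does not restrict the word read by the head. -/
def marker : Head → Symb
  | .left => .dr
  | .right => .dl

/-- `Scans q f i`: in state `q`, the head `f` may read the letters with index at least `i` among
`a`, `b`, `c`. -/
inductive Scans : State → Head → ℕ → Prop
  | start {f : Head} {i : ℕ} : Scans none f i
  | scanA {f : Head} {i : ℕ} : Scans (some (f, .scanA)) f i
  | scanB {f : Head} {i : ℕ} : 1 ≤ i → Scans (some (f, .scanB)) f i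
  | scanC {f : Head} {i : ℕ} : 2 ≤ i → Scans (some (f, .scanC)) f i

/-- The steps that read `a`. -/
inductive Push : State → Head → State × Bool → Prop
  | scan {q : State} {f : Head} : Scans q f 0 → Push q f (some (f, .scanA), true)
  | first {f : Head} : Push (some (f, .marked)) f.flip (some (f, .owing), true)
  | next {f : Head} : Push (some (f, .balanced)) f.flip (some (f, .owing), false)

/-- The steps that read `b`. -/
inductive Pop : State → Head → Option Bool → State → Prop
  | scan {q : State} {f : Head} {z : Option Bool} : Scans q f 1 → Pop q f z (some (f, .scanB))
  | more {f : Head} {t : Stage} : t = .balanced ∨ t = .popping →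
      Pop (some (f, t)) f.flip (some false) (some (f, .popping))
  | last {f : Head} {t : Stage} : t = .balanced ∨ t = .popping →
      Pop (some (f, t)) f.flip (some true) (some (f, .done))

/-- The steps that read `c` or a marker. -/
inductive Skip : State → Head → Symb → State → Prop
  | scan {q : State} {f : Head} : Scans q f 2 → Skip q f .c (some (f, .scanC))
  | mark {q : State} {f : Head} : Scans q f 2 → Skip q f (marker f) (some (f, .marked))
  | pay {f : Head} : Skip (some (f, .owing)) f .c (some (f, .balanced))

/-- The input-driven automaton that guesses the marker in its first step. The bottommost symbol
pushed after the marker was read is `true`, the others are `false`. -/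
def automaton : IDPDA Symb State Bool where
  sig _ x := match x with
    | .a => .push
    | .b => .pop
    | _ => .skip
  start := none
  accept := {q | ∃ f, q = some (f, .marked) ∨ q = some (f, .done)}
  pushδ q h _ _ := {p | Push q h p}
  popδ q h _ z := {p | Pop q h z p}
  skipδ q h x _ := {p | Skip q h x p}

/-- The rest of the input, as seen from the head `f` while it scans up to its marker. -/
def ScanWord (f : Head) (i : ℕ) (w : List Symb) : Prop :=
  ∃ n l j k, (1 ≤ i → k = 0) ∧ (2 ≤ i → j = 0) ∧
    w = abc n ++ marker f :: (List.replicate l .c ++ List.replicate j .b ++ List.replicate k .a)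

/-- The words that are accepted from a state and a pushdown content. -/
def Good (w : List Symb) (s : List Bool) : State → Prop
  | none => ∃ f : Head, ScanWord f 0 (f.orient w)
  | some (f, .scanA) => ScanWord f 0 (f.orient w)
  | some (f, .scanB) => ScanWord f 1 (f.orient w)
  | some (f, .scanC) => ScanWord f 2 (f.orient w)
  | some (f, .marked) => ∃ n, f.orient w = abc n
  | some (f, .owing) => ∀ m t, s = List.replicate m false ++ true :: t → ∃ k,
      f.orient w = List.replicate k .a ++ List.replicate (k + m + 1) .b ++ List.replicate (k + 1) .c
  | some (f, .balanced) => ∀ m t, s = List.replicate m false ++ true :: t → ∃ k,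
      f.orient w = List.replicate k .a ++ List.replicate (k + m + 1) .b ++ List.replicate k .c
  | some (f, .popping) => ∀ m t, s = List.replicate m false ++ true :: t →
      f.orient w = List.replicate (m + 1) .b
  | some (f, .done) => f.orient w = []

/-! ### The witness automaton accepts only words of the language -/

theorem ScanWord.mono {f : Head} {i j : ℕ} {w : List Symb} (h : ScanWord f j w) (hij : i ≤ j) :
    ScanWord f i w := by
  obtain ⟨n, l, j', k, h₁, h₂, hw⟩ := h
  exact ⟨n, l, j', k, fun hi => h₁ (hi.trans hij), fun hi => h₂ (hi.trans hij), hw⟩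

theorem Scans.good {q : State} {f : Head} {i : ℕ} {w : List Symb} {s : List Bool}
    (h : Scans q f i) (hw : ScanWord f i (f.orient w)) : Good w s q := by
  cases h with
  | start => exact ⟨f, hw.mono (Nat.zero_le _)⟩
  | scanA => exact ScanWord.mono hw (Nat.zero_le _)
  | scanB hi => exact ScanWord.mono hw hi
  | scanC hi => exact ScanWord.mono hw hi

/-- `Good` is carried backwards along a computation, so each step only has to put the symbol it read
back at its end of the word. -/
theorem good_of_push {q : State} {h : Head} {p : State × Bool} {w : List Symb} {s : List Bool}
    (hp : Push q h p) (hg : Good w (p.2 :: s) p.1) : Good (h.attach .a w) s q := by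
  cases hp with
  | scan hs =>
    obtain ⟨n, l, j, k, -, -, hw⟩ := hg
    refine hs.good ⟨n, l, j, k + 1, by simp, by simp, ?_⟩
    simp [hw, List.replicate_succ']
  | first =>
    -- The `true` just pushed lies on top, so no `false` precedes it, whatever scanning left below.
    obtain ⟨k, hk⟩ := hg 0 s rfl
    exact ⟨k + 1, by simp [hk, abc, List.replicate_succ]⟩
  | next =>
    intro m t hs
    obtain ⟨k, hk⟩ := hg (m + 1) t (by simp [hs, List.replicate_succ])
    exact ⟨k + 1, by simp [hk, List.replicate_succ, Nat.add_right_comm, ← Nat.add_assoc]⟩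

theorem good_of_pop {q p : State} {h : Head} {w : List Symb} {s : List Bool}
    (hp : Pop q h s.head? p) (hg : Good w s.tail p) : Good (h.attach .b w) s q := by
  generalize hz : s.head? = z at hp
  cases hp with
  | scan hs =>
    obtain ⟨n, l, j, k, hk, -, hw⟩ := hg
    refine hs.good ⟨n, l, j + 1, k, hk, by simp, ?_⟩
    simp [hw, List.replicate_succ', hk le_rfl]
  | @more f t ht =>
    obtain ⟨s, rfl⟩ := List.head?_eq_some_iff.1 hz
    have key : ∀ m t, false :: s = List.replicate m false ++ true :: t →
        f.orient (f.flip.attach .b w) = List.replicate (m + 1) .b := by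
      rintro (_ | m) t hs
      -- The top is `false`, so at least one `false` lies above the first `true`.
      · simp at hs
      · have := hg m t (by simpa [List.replicate_succ] using hs)
        simp [this, List.replicate_succ]
    rcases ht with rfl | rfl
    -- Once a `b` is matched, no `a` or `c` can be read any more, so `k = 0`.
    · exact fun m t hs => ⟨0, by simp [key m t hs, -Head.orient_attach_flip]⟩
    · exact key
  | @last f t ht =>
    obtain ⟨s, rfl⟩ := List.head?_eq_some_iff.1 hz
    have key : ∀ m t, true :: s = List.replicate m false ++ true :: t →
        f.orient (f.flip.attach .b w) = List.replicate (m + 1) .b := by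
      rintro (_ | m) t hs
      · have : f.orient w = [] := hg
        simp [this]
      · simp [List.replicate_succ] at hs
    rcases ht with rfl | rfl
    · exact fun m t hs => ⟨0, by simp [key m t hs, -Head.orient_attach_flip]⟩
    · exact key

theorem good_of_skip {q p : State} {h : Head} {x : Symb} {w : List Symb} {s : List Bool}
    (hp : Skip q h x p) (hg : Good w s p) : Good (h.attach x w) s q := by
  cases hp with
  | scan hs =>
    obtain ⟨n, l, j, k, hk, hj, hw⟩ := hg
    refine hs.good ⟨n, l + 1, j, k, hk, hj, ?_⟩
    simp [hw, List.replicate_succ', hk (by simp), hj le_rfl]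
  | mark hs =>
    obtain ⟨n, hn⟩ := hg
    exact hs.good ⟨n, 0, 0, 0, by simp, by simp, by simp [hn]⟩
  | pay =>
    intro m t hs
    obtain ⟨k, hk⟩ := hg m t hs
    exact ⟨k, by simp [hk, List.replicate_succ']⟩

theorem good_of_step {c c' : Config Symb State Bool} (h : automaton.Step c c')
    (hg : Good c'.2.1 c'.2.2 c'.1) : Good c.2.1 c.2.2 c.1 := by
  obtain ⟨h, hstep⟩ := h
  cases hstep with
  | @push _ _ x _ _ _ hs hp =>
    cases x <;> simp [automaton] at hs
    exact good_of_push hp hg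
  | @pop _ _ x _ _ hs hp =>
    cases x <;> simp [automaton] at hs
    exact good_of_pop hp hg
  | skip hs hp => exact good_of_skip hp hg

/-! ### The witness automaton accepts every word of the language -/

/-- `Accepts f q w s`: the automaton accepts from the state `q` and the pushdown content `s`, where
`w` is the unread input in the direction in which `f` is the right head. -/
def Accepts (f : Head) (q : State) (w : List Symb) (s : List Bool) : Prop :=
  ∃ q' ∈ automaton.accept, ∃ s' : List Bool,
    Relation.ReflTransGen automaton.Step (q, f.orient w, s) (q', [], s')

theorem accepts_of_stepBy {f h : Head} {q q' : State} {w w' : List Symb} {s s' : List Bool}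
    (hstep : automaton.StepBy h (q, f.orient w, s) (q', f.orient w', s'))
    (hacc : Accepts f q' w' s') : Accepts f q w s := by
  obtain ⟨r, hr, t, hrun⟩ := hacc
  exact ⟨r, hr, t, .head ⟨h, hstep⟩ hrun⟩

theorem orient_append_singleton (f : Head) (x : Symb) (w : List Symb) :
    f.orient (w ++ [x]) = f.attach x (f.orient w) := by
  cases f <;> simp [Head.orient, Head.attach]

theorem orient_cons (f : Head) (x : Symb) (w : List Symb) :
    f.orient (x :: w) = f.flip.attach x (f.orient w) := by
  cases f <;> simp [Head.orient, Head.attach, Head.flip]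

theorem accepts_done (f : Head) (s : List Bool) : Accepts f (some (f, .done)) [] s :=
  ⟨_, ⟨f, .inr rfl⟩, s, by simpa using .refl⟩

theorem accepts_popping (f : Head) (m : ℕ) (s : List Bool) {t : Stage}
    (ht : t = .balanced ∨ t = .popping) :
    Accepts f (some (f, t)) (List.replicate (m + 1) .b) (List.replicate m false ++ true :: s) := by
  induction m generalizing t with
  | zero =>
    refine accepts_of_stepBy (h := f.flip) ?_ (accepts_done f s)
    rw [List.replicate_succ, orient_cons]
    exact .pop rfl (.last ht)
  | succ m ih =>
    refine accepts_of_stepBy (h := f.flip) ?_ (ih (.inr rfl))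
    rw [List.replicate_succ, orient_cons]
    exact .pop (s := false :: (List.replicate m false ++ true :: s)) rfl (.more ht)

theorem accepts_owing (f : Head) {w : List Symb} {s : List Bool}
    (h : Accepts f (some (f, .balanced)) w s) : Accepts f (some (f, .owing)) (w ++ [.c]) s := by
  refine accepts_of_stepBy (h := f) ?_ h
  rw [orient_append_singleton]
  exact .skip rfl .pay

/-- Each round reads an `a` and a `c` from opposite ends and adds one `false`. The `b`s to come thus
match the `m` symbols `false`, the one `true`, and the `k` symbols still to be pushed. -/
theorem accepts_balanced (f : Head) (k m : ℕ) (s : List Bool) :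
    Accepts f (some (f, .balanced))
      (List.replicate k .a ++ List.replicate (k + m + 1) .b ++ List.replicate k .c)
      (List.replicate m false ++ true :: s) := by
  induction k generalizing m with
  | zero => simpa using accepts_popping f m s (.inl rfl)
  | succ k ih =>
    refine accepts_of_stepBy (h := f.flip) ?_ (accepts_owing f (ih (m + 1)))
    rw [List.replicate_succ, List.cons_append, List.cons_append, orient_cons,
      List.replicate_succ' (n := k) (a := Symb.c), ← List.append_assoc,
      show k + 1 + m + 1 = k + (m + 1) + 1 by omega]
    exact .push rfl .next

/-- The store `s` is arbitrary, since scanning leaves unpredictable contents; for `n > 0` the first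
`true` pushed separates them from the counter. -/
theorem accepts_marked (f : Head) (n : ℕ) (s : List Bool) :
    Accepts f (some (f, .marked)) (abc n) s := by
  cases n with
  | zero => exact ⟨_, ⟨f, .inl rfl⟩, s, by simpa [abc] using .refl⟩
  | succ n =>
    refine accepts_of_stepBy (h := f.flip) ?_ (accepts_owing f (accepts_balanced f n 0 s))
    rw [abc, List.replicate_succ, List.cons_append, List.cons_append, orient_cons,
      List.replicate_succ' (n := n) (a := Symb.c), ← List.append_assoc]
    exact .push rfl .first

theorem accepts_scanC (f : Head) (n l : ℕ) (s : List Bool) {q : State} (hq : Scans q f 2) :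
    Accepts f q (abc n ++ marker f :: List.replicate l .c) s := by
  induction l generalizing q with
  | zero =>
    refine accepts_of_stepBy (h := f) ?_ (accepts_marked f n s)
    rw [List.replicate_zero, orient_append_singleton]
    exact .skip (by cases f <;> rfl) (.mark hq)
  | succ l ih =>
    refine accepts_of_stepBy (h := f) ?_ (ih (.scanC le_rfl))
    rw [List.replicate_succ', ← List.cons_append, ← List.append_assoc, orient_append_singleton]
    exact .skip rfl (.scan hq)

theorem Scans.mono {q : State} {f : Head} {i j : ℕ} (h : Scans q f i) (hij : i ≤ j) :
    Scans q f j := by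
  cases h with
  | start => exact .start
  | scanA => exact .scanA
  | scanB h => exact .scanB (h.trans hij)
  | scanC h => exact .scanC (h.trans hij)

theorem accepts_scanB (f : Head) (n l j : ℕ) (s : List Bool) {q : State} (hq : Scans q f 1) :
    Accepts f q (abc n ++ marker f :: (List.replicate l .c ++ List.replicate j .b)) s := by
  induction j generalizing q s with
  | zero => simpa using accepts_scanC f n l s (hq.mono one_le_two)
  | succ j ih =>
    refine accepts_of_stepBy (h := f) ?_ (ih s.tail (.scanB le_rfl))
    rw [List.replicate_succ', ← List.append_assoc, ← List.cons_append, ← List.append_assoc,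
      orient_append_singleton]
    exact .pop rfl (.scan hq)

theorem accepts_scanA (f : Head) (n l j k : ℕ) (s : List Bool) {q : State} (hq : Scans q f 0) :
    Accepts f q (abc n ++ marker f ::
      (List.replicate l .c ++ List.replicate j .b ++ List.replicate k .a)) s := by
  induction k generalizing q s with
  | zero => simpa using accepts_scanB f n l j s (hq.mono zero_le_one)
  | succ k ih =>
    refine accepts_of_stepBy (h := f) ?_ (ih (true :: s) .scanA)
    rw [List.replicate_succ', ← List.append_assoc, ← List.cons_append, ← List.append_assoc,
      orient_append_singleton]
    exact .push rfl (.scan hq)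

theorem mem_Ldta_iff {w : List Symb} : w ∈ Ldta ↔ ∃ f : Head, ScanWord f 0 (f.orient w) := by
  constructor
  · rintro ⟨i, j, k, n, rfl | rfl⟩
    · exact ⟨.right, n, i, j, k, by simp, by simp, by simp [Head.orient, abc, marker]⟩
    · exact ⟨.left, n, k, j, i, by simp, by simp, by simp [Head.orient, abc, marker]⟩
  · rintro ⟨f, n, l, j, k, -, -, hw⟩
    rw [← f.orient_orient w, hw]
    cases f
    · exact ⟨k, j, l, n, .inr (by simp [Head.orient, abc, marker])⟩
    · exact ⟨l, j, k, n, .inl (by simp [Head.orient, abc, marker])⟩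

theorem automaton_language : automaton.language = Ldta := by
  ext w
  rw [mem_Ldta_iff]
  constructor
  · rintro ⟨q, hq, s, hrun⟩
    suffices H : ∀ c : Config Symb State Bool, Relation.ReflTransGen automaton.Step c (q, [], s) →
        Good c.2.1 c.2.2 c.1 from H _ hrun
    intro c hc
    induction hc using Relation.ReflTransGen.head_induction_on with
    | refl =>
      obtain ⟨f, rfl | rfl⟩ := hq
      · exact ⟨0, by simp [abc]⟩
      · exact f.orient_nil
    | head hstep _ ih => exact good_of_step hstep ih
  · rintro ⟨f, n, l, j, k, -, -, hw⟩
    have := accepts_scanA f n l j k [] (q := none) .start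
    rw [← hw, Accepts, f.orient_orient] at this
    exact this

end Witness

theorem Ldta_mem_NIDDHPDA : Ldta ∈ NIDDHPDA Symb :=
  ⟨Witness.State, Bool, inferInstance, inferInstance, Witness.automaton, rfl,
    Witness.automaton_language⟩

end DoubleHead

theorem mainTheorem1 :
    DoubleHead.StrictlyIncluded DoubleHead.DIDDHPDA DoubleHead.NIDDHPDA ∧
    DoubleHead.StrictlyIncluded DoubleHead.DDoIDDHPDA DoubleHead.NDoIDDHPDA ∧
    (DoubleHead.Ldta ∈ DoubleHead.NIDDHPDA DoubleHead.Symb ∧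
      DoubleHead.Ldta ∉ DoubleHead.DIDDHPDA DoubleHead.Symb) ∧
    (DoubleHead.Ldta ∈ DoubleHead.NDoIDDHPDA DoubleHead.Symb ∧
      DoubleHead.Ldta ∉ DoubleHead.DDoIDDHPDA DoubleHead.Symb) ∧
    DoubleHead.Ldta ∉ DoubleHead.DDHPDA DoubleHead.Symb := by
  open DoubleHead in
  have h₁ : Ldta ∉ DDHPDA Symb := Ldta_notMem_DDHPDA
  have h₂ : Ldta ∉ DDoIDDHPDA Symb := fun h => h₁ (DDoIDDHPDA_subset_DDHPDA _ h)
  have h₃ : Ldta ∉ DIDDHPDA Symb := fun h => h₂ (DIDDHPDA_subset_DDoIDDHPDA _ h)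
  have h₄ : Ldta ∈ NIDDHPDA Symb := Ldta_mem_NIDDHPDA
  have h₅ : Ldta ∈ NDoIDDHPDA Symb := NIDDHPDA_subset_NDoIDDHPDA _ h₄
  exact ⟨⟨fun α _ => DIDDHPDA_subset_NIDDHPDA α, Symb, inferInstance, Ldta, h₄, h₃⟩,
    ⟨fun α _ => DDoIDDHPDA_subset_NDoIDDHPDA α, Symb, inferInstance, Ldta, h₅, h₂⟩,
    ⟨h₄, h₃⟩, ⟨h₅, h₂⟩, h₁⟩
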